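/- All matrices are complex. For $n\times n$ matrices let $M\circ N$ denote the entrywise product, and for a matrix $M$ without zero entries let $M^{(-)}$ denote its entrywise inverse. For $n\times n$ matrices $A,B$ let $X_A(M)=AM$ and $\Delta_B(M)=B\circ M$ be the corresponding endomorphisms of the space of $n\times n$ matrices. The pair $(A,B)$ is a *one-sided Jones pair* if $X_A$ and $\Delta_B$ are invertible and $X_A\Delta_BX_A=\Delta_BX_A\Delta_B$; it is a *Jones pair* if $(A,B)$ and $(A,B^T)$ are both one-sided Jones pairs; and a Jones pair is *invertible* if moreover $A$ has no zero entry and $B$ is an invertible matrix. For an $m\times m$ matrix $W$ without zero entries, the *Nomura algebra* $\mathcal N_W$ is the set of all $m\times m$ matrices having every vector $We_i\circ W^{(-)}e_j$ ($1\le i,j\le m$) as an eigenvector. An $m\times m$ matrix $W$ without zero entries is a *spin model* if for some scalar $d$ with $d^2=m$ (the loop variable) it satisfies: (I) for some scalar $a\neq0$, all diagonal entries of $W$ equal $a$ and all row sums and column sums of $W$ equal $da^{-1}$; (II) $W\,(W^{(-)})^T=mI$; (III) $\sum_{k} W_{h,k}W_{k,i}/W_{k,j}=d\,W_{h,i}/(W_{i,j}W_{h,j})$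 for all $h,i,j$. **Lemma.** Let $(A,B)$ be an invertible Jones pair of $n\times n$ matrices, let $C$ be an invertible diagonal matrix with $A^T=C^{-2}AC^2$, and let $$W=\begin{pmatrix}A^T&-A^T\\ (B^{(-)})^TC&(B^{(-)})^TC\end{pmatrix}.$$ If $\mathcal N_W=\mathcal N_{W^T}$, then there is a nonzero scalar $\alpha$ such that $\alpha B$ is a spin model. -/

import Mathlib

open scoped Matrix

namespace JonesPairs

noncomputable section

variable {ι : Type*}

/-- The Schur (entrywise) inverse of a matrix; meaningful when no entry vanishes. -/
def schurInv (M : Matrix ι ι ℂ) : Matrix ι ι ℂ := Matrix.of fun i j => (M i j)⁻¹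

/-- A matrix is Schur invertible if all its entries are nonzero. -/
def SchurInvertible (M : Matrix ι ι ℂ) : Prop := ∀ i j, M i j ≠ 0

variable [Fintype ι] [DecidableEq ι]

/-- The endomorphism `X_A : M ↦ A M` of the space of square matrices. -/
def opX (A : Matrix ι ι ℂ) : Module.End ℂ (Matrix ι ι ℂ) := LinearMap.mulLeft ℂ A

/-- The endomorphism `Δ_B : M ↦ B ∘ M` (entrywise product) of the space of square matrices. -/
def opD (B : Matrix ι ι ℂ) : Module.End ℂ (Matrix ι ι ℂ) where
  toFun M := B ⊙ M
  map_add' M N := Matrix.hadamard_add B M N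
  map_smul' c M := Matrix.hadamard_smul B M c

/-- `(A, B)` is a one-sided Jones pair: `X_A` and `Δ_B` are invertible and satisfy the
braid relation. -/
structure IsOneSidedJonesPair (A B : Matrix ι ι ℂ) : Prop where
  isUnit_opX : IsUnit (opX A)
  isUnit_opD : IsUnit (opD B)
  braid : opX A * opD B * opX A = opD B * opX A * opD B

/-- `(A, B)` is a Jones pair: both `(A, B)` and `(A, Bᵀ)` are one-sided Jones pairs. -/
structure IsJonesPair (A B : Matrix ι ι ℂ) : Prop where
  left : IsOneSidedJonesPair A B
  right : IsOneSidedJonesPair A Bᵀ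

/-- An invertible Jones pair: moreover `A` is Schur invertible and `B` is invertible. -/
structure IsInvertibleJonesPair (A B : Matrix ι ι ℂ) : Prop where
  isJonesPair : IsJonesPair A B
  schurInvertible : SchurInvertible A
  isUnit : IsUnit B

/-- A type-II matrix: `W (W⁽⁻⁾)ᵀ = n I`. -/
def IsTypeII (W : Matrix ι ι ℂ) : Prop :=
  SchurInvertible W ∧ W * (schurInv W)ᵀ = (Fintype.card ι : ℂ) • (1 : Matrix ι ι ℂ)

/-- The vector `W eᵢ ∘ W⁽⁻⁾ eⱼ`. -/
def ratioVec (W : Matrix ι ι ℂ) (i j : ι) : ι → ℂ := fun k => W k i * schurInv W k j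

/-- The Nomura algebra of `W`: the matrices having every `W eᵢ ∘ W⁽⁻⁾ eⱼ` as an eigenvector. -/
def nomura (W : Matrix ι ι ℂ) : Subalgebra ℂ (Matrix ι ι ℂ) where
  carrier := {M | ∀ i j, ∃ μ : ℂ, M *ᵥ ratioVec W i j = μ • ratioVec W i j}
  mul_mem' := by
    intro M N hM hN i j
    obtain ⟨μ, hμ⟩ := hM i j
    obtain ⟨ν, hν⟩ := hN i j
    exact ⟨ν * μ, by rw [← Matrix.mulVec_mulVec, hν, Matrix.mulVec_smul, hμ, smul_smul]⟩
  add_mem' := by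
    intro M N hM hN i j
    obtain ⟨μ, hμ⟩ := hM i j
    obtain ⟨ν, hν⟩ := hN i j
    exact ⟨μ + ν, by rw [Matrix.add_mulVec, hμ, hν, add_smul]⟩
  algebraMap_mem' := by
    intro r i j
    exact ⟨r, by rw [Algebra.algebraMap_eq_smul_one, Matrix.smul_mulVec, Matrix.one_mulVec]⟩

/-- `W` is a spin model with loop variable `d`: `d² = n` and `W` satisfies
the type-I condition (constant diagonal `a ≠ 0` and constant row and column sums `d a⁻¹`),
the type-II condition, and the type-III (star-triangle) condition. -/
structure IsSpinModelWith (W : Matrix ι ι ℂ) (d : ℂ) : Prop where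
  loop : d ^ 2 = (Fintype.card ι : ℂ)
  typeI : ∃ a : ℂ, a ≠ 0 ∧ (∀ i, W i i = a) ∧
    (∀ i, ∑ j, W i j = d * a⁻¹) ∧ (∀ j, ∑ i, W i j = d * a⁻¹)
  typeII : IsTypeII W
  typeIII : ∀ h i j, ∑ k, W h k * W k i / W k j = d * W h i / (W i j * W h j)

/-- A spin model, with some loop variable. -/
def IsSpinModel (W : Matrix ι ι ℂ) : Prop := ∃ d : ℂ, IsSpinModelWith W d

/-- The `2n × 2n` matrix `W` built from `A`, `B` and the diagonal matrix `C`. -/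
def matW (A B C : Matrix ι ι ℂ) : Matrix (ι ⊕ ι) (ι ⊕ ι) ℂ :=
  Matrix.fromBlocks Aᵀ (-Aᵀ) ((schurInv B)ᵀ * C) ((schurInv B)ᵀ * C)

end

end JonesPairs

/-! On matrix units the braid relation reads `A D A = D A D`, where `D` is the diagonal matrix of a
column of `B`. Its conjugate forms show that `A` and `B` are type II and that `Bᵀ` and `B` exchange,
up to scalars, the row ratios of `A` and of `B`. Hence the block matrix with off-diagonal blocks
`B`, `Bᵀ` lies in the Nomura algebra of `W` (`fromBlocks_mem_nomura_matW`). By hypothesis it also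
lies in that of `Wᵀ`, so `B` and `Bᵀ` act alike on the column ratios of `A`. These span, so `B` is
symmetric. The braid relation also makes column ratios of `B` multiples of those of `A`, hence
eigenvectors of `B`: this is the star-triangle relation up to a constant (`star_triangle`), which
scaling corrects. -/

namespace JonesPairs

open Matrix

variable {ι : Type*} [Fintype ι] [DecidableEq ι] {A B C : Matrix ι ι ℂ}

/-! ### Conjugate forms of the braid relation -/

section Braid

variable {D D' : Matrix ι ι ℂ}

lemma conj_eq_of_braid (hA : A * A⁻¹ = 1) (hD : D' * D = 1) (h : A * D * A = D * A * D) :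
    A * D * A⁻¹ = D' * A * D := by
  calc A * D * A⁻¹ = D' * D * (A * D) * A⁻¹ := by rw [hD, Matrix.one_mul]
    _ = D' * (D * A * D) * A⁻¹ := by simp only [Matrix.mul_assoc]
    _ = D' * (A * D * A) * A⁻¹ := by rw [h]
    _ = D' * A * D * (A * A⁻¹) := by simp only [Matrix.mul_assoc]
    _ = D' * A * D := by rw [hA, Matrix.mul_one]

lemma inv_conj_eq_of_braid (hA : A⁻¹ * A = 1) (hD : D * D' = 1) (h : A * D * A = D * A * D) :
    A⁻¹ * D * A = D * A * D' := by
  calc A⁻¹ * D * A = A⁻¹ * (D * A) * (D * D') := by rw [hD, Matrix.mul_one, Matrix.mul_assoc]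
    _ = A⁻¹ * (D * A * D) * D' := by simp only [Matrix.mul_assoc]
    _ = A⁻¹ * (A * D * A) * D' := by rw [h]
    _ = A⁻¹ * A * D * A * D' := by simp only [Matrix.mul_assoc]
    _ = D * A * D' := by rw [hA, Matrix.one_mul]

lemma conj_inv_eq_of_braid (hA : A * A⁻¹ = 1) (hA' : A⁻¹ * A = 1) (hD : D * D' = 1)
    (hD' : D' * D = 1) (h : A * D * A = D * A * D) :
    A * D' * A⁻¹ = D' * A⁻¹ * D := by
  have h1 := conj_eq_of_braid hA hD' h
  have h2 : (A * D * A⁻¹) * (D' * A⁻¹ * D) = 1 := by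
    rw [h1]
    calc D' * A * D * (D' * A⁻¹ * D) = D' * A * (D * D') * A⁻¹ * D := by
          simp only [Matrix.mul_assoc]
      _ = D' * (A * A⁻¹) * D := by rw [hD]; simp only [Matrix.mul_one, Matrix.mul_assoc]
      _ = 1 := by rw [hA, Matrix.mul_one, hD']
  have h3 : (A * D' * A⁻¹) * (A * D * A⁻¹) = 1 := by
    calc A * D' * A⁻¹ * (A * D * A⁻¹) = A * D' * (A⁻¹ * A) * D * A⁻¹ := by
          simp only [Matrix.mul_assoc]
      _ = A * (D' * D) * A⁻¹ := by rw [hA']; simp only [Matrix.mul_one, Matrix.mul_assoc]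
      _ = 1 := by rw [hD', Matrix.mul_one, hA]
  exact left_inv_eq_right_inv h3 h2

end Braid

/-! ### Entrywise consequences for a one-sided pair -/

namespace IsOneSidedJonesPair

variable (h : IsOneSidedJonesPair A B)
include h

lemma isUnit : IsUnit A := by
  obtain ⟨M, hM⟩ := ((Module.End.isUnit_iff _).1 h.isUnit_opX).2 1
  exact (isUnit_iff_isUnit_det A).2 (isUnit_det_of_right_inverse (B := M) hM)

lemma mul_inv : A * A⁻¹ = 1 := Matrix.mul_nonsing_inv _ ((isUnit_iff_isUnit_det A).1 h.isUnit)

lemma inv_mul : A⁻¹ * A = 1 := Matrix.nonsing_inv_mul _ ((isUnit_iff_isUnit_det A).1 h.isUnit)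

lemma schurInvertible : SchurInvertible B := by
  intro i j hij
  have hinj := ((Module.End.isUnit_iff _).1 h.isUnit_opD).1
  have h0 : opD B (single i j 1) = opD B 0 := by
    rw [map_zero]
    ext x y
    by_cases hxy : i = x ∧ j = y
    · obtain ⟨rfl, rfl⟩ := hxy
      simp [opD, hij]
    · simp [opD, single, hxy]
  simpa using congrFun (congrFun (hinj h0) i) j

/-- Evaluate the operator identity on the matrix units `single i j 1`: both operators preserve the
space of matrices supported in column `j`, where `Δ_B` acts as this diagonal matrix. -/
lemma braid_diagonal (j : ι) :
    A * diagonal (fun k => B k j) * A =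
      diagonal (fun k => B k j) * A * diagonal (fun k => B k j) := by
  ext x i
  have h1 := congrFun (congrFun (LinearMap.congr_fun h.braid (single i j 1)) x) j
  simp only [opX, opD, Module.End.mul_apply, LinearMap.mulLeft_apply, LinearMap.coe_mk,
    AddHom.coe_mk] at h1
  have h2 : B ⊙ single i j (1 : ℂ) = single i j (B i j) := by
    ext x y
    by_cases hxy : i = x ∧ j = y
    · obtain ⟨rfl, rfl⟩ := hxy
      simp
    · simp [single, hxy]
  rw [h2] at h1
  rw [hadamard_apply, mul_single_apply_same, mul_apply] at h1
  simp only [hadamard_apply, mul_single_apply_same, mul_one] at h1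
  rw [mul_diagonal, diagonal_mul, mul_assoc (B x j), ← h1, mul_apply]
  simp only [mul_diagonal, mul_assoc]

lemma diagonal_mul_diagonal_inv (j : ι) :
    diagonal (fun k => B k j) * diagonal (fun k => (B k j)⁻¹) = 1 := by
  rw [diagonal_mul_diagonal, ← diagonal_one]
  congr 1
  ext k
  exact mul_inv_cancel₀ (h.schurInvertible k j)

lemma diagonal_inv_mul_diagonal (j : ι) :
    diagonal (fun k => (B k j)⁻¹) * diagonal (fun k => B k j) = 1 := by
  rw [diagonal_mul_diagonal, ← diagonal_one]
  congr 1
  ext k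
  exact inv_mul_cancel₀ (h.schurInvertible k j)

/-- The column sums of `B` all equal the trace of `A`. -/
lemma sum_col (j : ι) : ∑ k, B k j = A.trace := by
  have h1 := congrArg trace
    (conj_eq_of_braid h.mul_inv (h.diagonal_inv_mul_diagonal j) (h.braid_diagonal j))
  rw [trace_mul_comm, ← Matrix.mul_assoc, h.inv_mul, Matrix.one_mul, trace_diagonal,
    trace_mul_comm, ← Matrix.mul_assoc, h.diagonal_mul_diagonal_inv, Matrix.one_mul] at h1
  exact h1

lemma sum_conj (x i j : ι) :
    ∑ k, A x k * B k j * A⁻¹ k i = (B x j)⁻¹ * A x i * B i j := by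
  have h1 := congrFun (congrFun (conj_eq_of_braid h.mul_inv
    (h.diagonal_inv_mul_diagonal j) (h.braid_diagonal j)) x) i
  rw [mul_apply] at h1
  simpa only [mul_diagonal, diagonal_mul] using h1

lemma sum_inv_conj (x i j : ι) :
    ∑ k, A⁻¹ x k * B k j * A k i = B x j * A x i * (B i j)⁻¹ := by
  have h1 := congrFun (congrFun (inv_conj_eq_of_braid h.inv_mul
    (h.diagonal_mul_diagonal_inv j) (h.braid_diagonal j)) x) i
  rw [mul_apply] at h1
  simpa only [mul_diagonal, diagonal_mul] using h1

lemma sum_conj_inv (x i j : ι) :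
    ∑ k, A x k * (B k j)⁻¹ * A⁻¹ k i = (B x j)⁻¹ * A⁻¹ x i * B i j := by
  have h1 := congrFun (congrFun (conj_inv_eq_of_braid h.mul_inv h.inv_mul
    (h.diagonal_mul_diagonal_inv j) (h.diagonal_inv_mul_diagonal j) (h.braid_diagonal j)) x) i
  rw [mul_apply] at h1
  simpa only [mul_diagonal, diagonal_mul] using h1

end IsOneSidedJonesPair

/-! ### Type-II property and exchange of ratios -/

namespace IsInvertibleJonesPair

variable (h : IsInvertibleJonesPair A B)
include h

lemma sum_row (i : ι) : ∑ k, B i k = A.trace := h.isJonesPair.right.sum_col i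

/-- The all-ones vector is an eigenvector of the invertible matrix `B` with eigenvalue `A.trace`. -/
lemma trace_ne_zero [Nonempty ι] : A.trace ≠ 0 := by
  intro h0
  have h1 : B *ᵥ (fun _ => (1 : ℂ)) = 0 := by
    ext i
    simp [mulVec, dotProduct, h.sum_row, h0]
  have h2 := congrFun (mulVec_injective_of_isUnit h.isUnit (h1.trans (mulVec_zero B).symm))
    (Classical.arbitrary ι)
  simp at h2

/-- `A⁻¹ ∘ Aᵀ` has constant rows. -/
lemma inv_mul_apply [Nonempty ι] (i k : ι) : A⁻¹ i k * A k i = A i i * A.trace⁻¹ := by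
  have hβ := h.trace_ne_zero
  -- Both row vectors have the same product with every column of `B`, and `B` is invertible.
  have h1 : (fun k => A⁻¹ i k * A k i) ᵥ* B = (fun _ => A i i * A.trace⁻¹) ᵥ* B := by
    ext j
    have hB := h.isJonesPair.left.schurInvertible i j
    have h2 := h.isJonesPair.left.sum_inv_conj i i j
    simp only [vecMul, dotProduct]
    rw [← Finset.mul_sum, h.isJonesPair.left.sum_col, inv_mul_cancel_right₀ hβ]
    calc _ = ∑ k, A⁻¹ i k * B k j * A k i := Finset.sum_congr rfl fun k _ => by ring
      _ = A i i := by rw [h2]; field_simp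
  exact congrFun (vecMul_injective_of_isUnit h.isUnit h1) k

lemma card_mul_diag [Nonempty ι] (i : ι) : (Fintype.card ι : ℂ) * A i i = A.trace := by
  have h1 : ∑ k, A⁻¹ i k * A k i = 1 := by
    rw [← mul_apply, h.isJonesPair.left.inv_mul, one_apply_eq]
  simp only [h.inv_mul_apply, Finset.sum_const, Finset.card_univ, nsmul_eq_mul] at h1
  have hβ := h.trace_ne_zero
  field_simp at h1
  exact h1

/-- This is the type-II property of `A`; it turns the conjugation identities into statements about
ratios. -/
lemma inv_apply [Nonempty ι] (i k : ι) :
    A⁻¹ i k = (Fintype.card ι : ℂ)⁻¹ * (A k i)⁻¹ := by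
  have h1 := h.inv_mul_apply i k
  have h2 := h.card_mul_diag i
  have hβ := h.trace_ne_zero
  have hA := h.schurInvertible k i
  have hn : (Fintype.card ι : ℂ) ≠ 0 := Nat.cast_ne_zero.2 Fintype.card_ne_zero
  rw [← h2] at h1
  have := h.schurInvertible i i
  field_simp at h1 ⊢
  linear_combination h1

lemma sum_div_row [Nonempty ι] (x i : ι) :
    ∑ k, A x k * (A i k)⁻¹ = if x = i then (Fintype.card ι : ℂ) else 0 := by
  have hn : (Fintype.card ι : ℂ) ≠ 0 := Nat.cast_ne_zero.2 Fintype.card_ne_zero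
  have h1 : ∑ k, A x k * A⁻¹ k i = (1 : Matrix ι ι ℂ) x i := by
    rw [← mul_apply, h.isJonesPair.left.mul_inv]
  simp only [h.inv_apply] at h1
  have h2 : ∑ k, A x k * (A i k)⁻¹ = (Fintype.card ι : ℂ) * (1 : Matrix ι ι ℂ) x i := by
    rw [← h1, Finset.mul_sum]
    exact Finset.sum_congr rfl fun k _ => by field_simp
  rw [h2, one_apply]
  split_ifs <;> simp

/-- `Bᵀ` sends the row ratios of `A` to multiples of the row ratios of `B`. -/
lemma sum_mul_row_ratio [Nonempty ι] (x i j : ι) :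
    ∑ k, B k j * (A x k * (A i k)⁻¹) =
      (Fintype.card ι : ℂ) * A x i * (B i j * (B x j)⁻¹) := by
  have hn : (Fintype.card ι : ℂ) ≠ 0 := Nat.cast_ne_zero.2 Fintype.card_ne_zero
  have h1 := h.isJonesPair.left.sum_conj x i j
  simp only [h.inv_apply] at h1
  have h2 : ∑ k, B k j * (A x k * (A i k)⁻¹) = (Fintype.card ι : ℂ) *
      ∑ k, A x k * B k j * ((Fintype.card ι : ℂ)⁻¹ * (A i k)⁻¹) := by
    rw [Finset.mul_sum]
    exact Finset.sum_congr rfl fun k _ => by field_simp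
  rw [h2, h1]
  ring

lemma sum_mul_col_ratio [Nonempty ι] (x i j : ι) :
    ∑ k, B k j * (A k i * (A k x)⁻¹) =
      (Fintype.card ι : ℂ) * A x i * (B x j * (B i j)⁻¹) := by
  have hn : (Fintype.card ι : ℂ) ≠ 0 := Nat.cast_ne_zero.2 Fintype.card_ne_zero
  have h1 := h.isJonesPair.left.sum_inv_conj x i j
  simp only [h.inv_apply] at h1
  have h2 : ∑ k, B k j * (A k i * (A k x)⁻¹) = (Fintype.card ι : ℂ) *
      ∑ k, (Fintype.card ι : ℂ)⁻¹ * (A k x)⁻¹ * B k j * A k i := by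
    rw [Finset.mul_sum]
    exact Finset.sum_congr rfl fun k _ => by field_simp
  rw [h2, h1]
  ring

lemma sum_inv_mul_row_ratio [Nonempty ι] (x i j : ι) :
    ∑ k, (B k j)⁻¹ * (A x k * (A i k)⁻¹) = (A i x)⁻¹ * (B i j * (B x j)⁻¹) := by
  have hn : (Fintype.card ι : ℂ) ≠ 0 := Nat.cast_ne_zero.2 Fintype.card_ne_zero
  have h1 := h.isJonesPair.left.sum_conj_inv x i j
  simp only [h.inv_apply] at h1
  have h2 : ∑ k, (B k j)⁻¹ * (A x k * (A i k)⁻¹) = (Fintype.card ι : ℂ) *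
      ∑ k, A x k * (B k j)⁻¹ * ((Fintype.card ι : ℂ)⁻¹ * (A i k)⁻¹) := by
    rw [Finset.mul_sum]
    exact Finset.sum_congr rfl fun k _ => by field_simp
  rw [h2, h1]
  field_simp

lemma isTypeII_right [Nonempty ι] : IsTypeII B := by
  refine ⟨h.isJonesPair.left.schurInvertible, ?_⟩
  have hn : (Fintype.card ι : ℂ) ≠ 0 := Nat.cast_ne_zero.2 Fintype.card_ne_zero
  ext i x
  simp only [mul_apply, transpose_apply, schurInv, of_apply, Matrix.smul_apply, smul_eq_mul]
  by_cases hxi : i = x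
  · subst hxi
    simp [h.isJonesPair.left.schurInvertible i _]
  · rw [one_apply_ne hxi, mul_zero]
    -- Sum `sum_mul_row_ratio` over `j`: constant row sums of `B` leave a multiple of the inner
    -- product of row `x` of `A` with the entrywise inverse of row `i`, which vanishes.
    have h1 : (Fintype.card ι : ℂ) * A x i * ∑ j, B i j * (B x j)⁻¹ = 0 := by
      rw [Finset.mul_sum]
      simp only [← h.sum_mul_row_ratio]
      rw [Finset.sum_comm]
      simp only [← Finset.sum_mul, h.sum_row]
      rw [← Finset.mul_sum, h.sum_div_row, if_neg (Ne.symm hxi), mul_zero]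
    exact (mul_eq_zero.1 h1).resolve_left (mul_ne_zero hn (h.schurInvertible x i))

/-- `B` sends the row ratios of `B` to multiples of the row ratios of `A`. -/
lemma sum_mul_ratio_right [Nonempty ι] (x i l : ι) :
    ∑ j, B l j * (B i j * (B x j)⁻¹) =
      (Fintype.card ι : ℂ) * A i x * (A x l * (A i l)⁻¹) := by
  have hB := h.isTypeII_right
  -- The ratio is expanded in the rows of `schurInv B`, which are dual to the rows of `B` by type
  -- II.
  have h1 : ∀ j, B i j * (B x j)⁻¹ = A i x * ∑ k, (B k j)⁻¹ * (A x k * (A i k)⁻¹) := by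
    intro j
    rw [h.sum_inv_mul_row_ratio, mul_inv_cancel_left₀ (h.schurInvertible i x)]
  have h2 : ∀ k, ∑ j, B l j * (B k j)⁻¹ = (Fintype.card ι : ℂ) * (1 : Matrix ι ι ℂ) l k := by
    intro k
    have := congrFun (congrFun hB.2 l) k
    simpa only [mul_apply, transpose_apply, schurInv, of_apply, Matrix.smul_apply, smul_eq_mul]
      using this
  calc ∑ j, B l j * (B i j * (B x j)⁻¹)
      = ∑ k, ∑ j, A i x * (A x k * (A i k)⁻¹) * (B l j * (B k j)⁻¹) := by
        rw [Finset.sum_comm]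
        refine Finset.sum_congr rfl fun j _ => ?_
        rw [h1, Finset.mul_sum, Finset.mul_sum]
        exact Finset.sum_congr rfl fun k _ => by ring
    _ = ∑ k, A i x * (A x k * (A i k)⁻¹) * ((Fintype.card ι : ℂ) * (1 : Matrix ι ι ℂ) l k) := by
        simp only [← Finset.mul_sum, h2]
    _ = _ := by
        simp only [one_apply, mul_ite, mul_one, mul_zero, Finset.sum_ite_eq, Finset.mem_univ,
          if_true]
        ring

end IsInvertibleJonesPair

/-! ### Nomura algebras of `W` and its transpose -/

/-- The matrix with off-diagonal blocks `B` and `Bᵀ` lies in the Nomura algebra of `matW`. -/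
lemma fromBlocks_mem_nomura_matW [Nonempty ι] {c : ι → ℂ} (h : IsInvertibleJonesPair A B)
    (hc : ∀ i, c i ≠ 0) (hA : ∀ i j, c i ^ 2 * A j i = A i j * c j ^ 2) :
    fromBlocks 0 B Bᵀ 0 ∈ nomura (matW A B (diagonal c)) := by
  -- The sign `s` records the block `-Aᵀ`: it is `-1` exactly when the two columns come from
  -- different halves.
  have key : ∀ (i j : ι) (s : ℂ), s * s = 1 →
      fromBlocks 0 B Bᵀ 0 *ᵥ (Sum.elim (fun k => s * (A i k * (A j k)⁻¹))
        (fun k => c i * (c j)⁻¹ * (B j k * (B i k)⁻¹))) =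
      (s * (Fintype.card ι * (c j * A i j * (c i)⁻¹))) •
        (Sum.elim (fun k => s * (A i k * (A j k)⁻¹))
        (fun k => c i * (c j)⁻¹ * (B j k * (B i k)⁻¹))) := by
    intro i j s hs
    have hi := hc i
    have hj := hc j
    rw [fromBlocks_mulVec]
    ext (l | l)
    · have h1 := h.sum_mul_ratio_right i j l
      simp only [Sum.elim_comp_inl, Sum.elim_comp_inr, zero_mulVec, zero_add, Sum.elim_inl,
        Pi.smul_apply, smul_eq_mul, mulVec, dotProduct]
      calc ∑ k, B l k * (c i * (c j)⁻¹ * (B j k * (B i k)⁻¹))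
          = c i * (c j)⁻¹ * ∑ k, B l k * (B j k * (B i k)⁻¹) := by
            rw [Finset.mul_sum]
            exact Finset.sum_congr rfl fun k _ => by ring
        _ = Fintype.card ι * (c i * A j i * (c j)⁻¹) * (A i l * (A j l)⁻¹) := by
            rw [h1]; ring
        -- The relation between `A`, `Aᵀ` and `C` makes the eigenvalues from the two halves agree.
        _ = Fintype.card ι * (c j * A i j * (c i)⁻¹) * (A i l * (A j l)⁻¹) := by
            congr 2
            field_simp
            linear_combination hA i j
        _ = (s * s) * (Fintype.card ι * (c j * A i j * (c i)⁻¹) * (A i l * (A j l)⁻¹)) := by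
            rw [hs, one_mul]
        _ = _ := by ring
    · have h1 := h.sum_mul_row_ratio i j l
      simp only [Sum.elim_comp_inl, Sum.elim_comp_inr, zero_mulVec, add_zero, Sum.elim_inr,
        Pi.smul_apply, smul_eq_mul, mulVec, dotProduct, transpose_apply]
      calc ∑ k, B k l * (s * (A i k * (A j k)⁻¹))
          = s * ∑ k, B k l * (A i k * (A j k)⁻¹) := by
            rw [Finset.mul_sum]
            exact Finset.sum_congr rfl fun k _ => by ring
        _ = _ := by
            rw [h1]
            field_simp
  have ratio : ∀ p q : ι ⊕ ι, ∃ i j s, s * s = 1 ∧ ratioVec (matW A B (diagonal c)) p q =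
      Sum.elim (fun k => s * (A i k * (A j k)⁻¹))
        (fun k => c i * (c j)⁻¹ * (B j k * (B i k)⁻¹)) := by
    rintro (i | i) (j | j)
    · refine ⟨i, j, 1, by norm_num, ?_⟩
      ext (k | k) <;> simp [ratioVec, matW, schurInv, mul_diagonal]
      ring
    · refine ⟨i, j, -1, by norm_num, ?_⟩
      ext (k | k) <;> simp [ratioVec, matW, schurInv, mul_diagonal, inv_neg]
      ring
    · refine ⟨i, j, -1, by norm_num, ?_⟩
      ext (k | k) <;> simp [ratioVec, matW, schurInv, mul_diagonal]
      ring
    · refine ⟨i, j, 1, by norm_num, ?_⟩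
      ext (k | k) <;> simp [ratioVec, matW, schurInv, mul_diagonal, inv_neg]
      ring
  intro p q
  obtain ⟨i, j, s, hs, hr⟩ := ratio p q
  exact ⟨_, by rw [hr]; exact key i j s hs⟩

/-- Membership in the Nomura algebra of `matWᵀ` makes the column ratios of `A` common
eigenvectors of `B` and `Bᵀ`. -/
lemma exists_eigenvalue_of_fromBlocks_mem
    (h : fromBlocks 0 B Bᵀ 0 ∈ nomura (matW A B C)ᵀ) (i j : ι) :
    ∃ μ : ℂ, ∀ x, ∑ k, B x k * (A k i * (A k j)⁻¹) = μ * (A x i * (A x j)⁻¹) ∧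
      ∑ k, B k x * (A k i * (A k j)⁻¹) = μ * (A x i * (A x j)⁻¹) := by
  obtain ⟨μ, hμ⟩ := h (Sum.inl i) (Sum.inl j)
  have hr : ratioVec (matW A B C)ᵀ (Sum.inl i) (Sum.inl j) =
      Sum.elim (fun k => A k i * (A k j)⁻¹) (fun k => A k i * (A k j)⁻¹) := by
    ext (k | k) <;> simp [ratioVec, matW, schurInv, inv_neg]
  rw [hr, fromBlocks_mulVec] at hμ
  refine ⟨μ, fun x => ⟨?_, ?_⟩⟩
  · simpa [mulVec, dotProduct] using congrFun hμ (Sum.inl x)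
  · simpa [mulVec, dotProduct] using congrFun hμ (Sum.inr x)

/-! ### Star-triangle relation and scaling -/

/-- An invertible Jones pair such that `B` is symmetric and the column ratios of `A` are
eigenvectors of `B` satisfies the star-triangle relation up to scaling. -/
lemma IsInvertibleJonesPair.star_triangle [Nonempty ι] (h : IsInvertibleJonesPair A B)
    (hsymm : ∀ x y, B x y = B y x) (μ : ι → ι → ℂ)
    (hμ : ∀ i j x, ∑ k, B x k * (A k i * (A k j)⁻¹) = μ i j * (A x i * (A x j)⁻¹)) :
    ∃ b, b ≠ 0 ∧ (∀ i, B i i = b) ∧ ∀ r i j,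
      ∑ k, B r k * B k i / B k j = A.trace * b * B r i / (B i j * B r j) := by
  have hn : (Fintype.card ι : ℂ) ≠ 0 := Nat.cast_ne_zero.2 Fintype.card_ne_zero
  have hB := h.isJonesPair.left.schurInvertible
  have hA := h.schurInvertible
  have hprop : ∀ i j x, (Fintype.card ι : ℂ) * A j i * (B j x * (B i x)⁻¹) =
      μ i j * (A x i * (A x j)⁻¹) := by
    intro i j x
    rw [← h.sum_mul_col_ratio, ← hμ]
    exact Finset.sum_congr rfl fun k _ => by rw [hsymm]
  have hval : ∀ i j, μ i j = A.trace * B j j * (B i j)⁻¹ := by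
    intro i j
    have h1 := hprop i j j
    have h2 := h.card_mul_diag j
    have := hA j i
    have := hA j j
    have := hB i j
    rw [← h2]
    field_simp at h1 ⊢
    linear_combination -h1
  -- The `(i, j)` and `(j, i)` ratios are entrywise inverse, so pairing them through the symmetric
  -- form `B` gives both `n * μ i j` and `n * μ j i`.
  have hμsymm : ∀ i j, μ i j = μ j i := by
    intro i j
    have pair : ∀ i j, ∑ x, (A x j * (A x i)⁻¹) * ∑ k, B x k * (A k i * (A k j)⁻¹) =
        μ i j * Fintype.card ι := by
      intro i j
      simp only [hμ]
      have : ∀ x, A x j * (A x i)⁻¹ * (μ i j * (A x i * (A x j)⁻¹)) = μ i j := by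
        intro x
        have := hA x i
        have := hA x j
        field_simp
      simp only [this, Finset.sum_const, Finset.card_univ, nsmul_eq_mul, mul_comm]
    have h1 := pair i j
    have h2 := pair j i
    refine mul_right_cancel₀ hn (h1.symm.trans (Eq.trans ?_ h2))
    simp only [Finset.mul_sum]
    rw [Finset.sum_comm]
    refine Finset.sum_congr rfl fun k _ => Finset.sum_congr rfl fun x _ => ?_
    rw [hsymm x k]
    ring
  have hdiag : ∀ i j, B i i = B j j := by
    intro i j
    have h1 := hμsymm j i
    rw [hval, hval, hsymm j i] at h1
    exact mul_left_cancel₀ h.trace_ne_zero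
      (mul_right_cancel₀ (inv_ne_zero (hB i j)) h1)
  obtain ⟨o⟩ := ‹Nonempty ι›
  refine ⟨B o o, hB o o, fun i => hdiag i o, fun r i j => ?_⟩
  have hratio : ∀ x, B x i / B x j =
      μ j i * ((Fintype.card ι : ℂ) * A i j)⁻¹ * (A x j * (A x i)⁻¹) := by
    intro x
    have h1 := hprop j i x
    have := hA i j
    have := hB j x
    rw [hsymm x i, hsymm x j]
    field_simp at h1 ⊢
    linear_combination h1
  calc ∑ k, B r k * B k i / B k j
      = μ j i * ((Fintype.card ι : ℂ) * A i j)⁻¹ * ∑ k, B r k * (A k j * (A k i)⁻¹) := by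
        rw [Finset.mul_sum]
        refine Finset.sum_congr rfl fun k _ => ?_
        rw [mul_div_assoc, hratio]
        ring
    _ = μ j i * (B r i / B r j) := by rw [hμ, hratio]; ring
    _ = _ := by
        rw [hval, hdiag i o, hsymm j i]
        have := hB i j
        have := hB r j
        field_simp

/-- Conditions (I) and (III) for `α • B` impose the same normalisation `d = α ^ 2 * (β * b)`, which
has a solution `α` over `ℂ`; (II) is scale invariant. -/
lemma isSpinModel_smul_of_star_triangle [Nonempty ι] {β b : ℂ} (hβ : β ≠ 0) (hb : b ≠ 0)
    (hB : IsTypeII B) (hrow : ∀ i, ∑ j, B i j = β) (hcol : ∀ j, ∑ i, B i j = β)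
    (hdiag : ∀ i, B i i = b)
    (hstar : ∀ r i j, ∑ k, B r k * B k i / B k j = β * b * B r i / (B i j * B r j)) :
    ∃ α : ℂ, α ≠ 0 ∧ IsSpinModel (α • B) := by
  have hn : (Fintype.card ι : ℂ) ≠ 0 := Nat.cast_ne_zero.2 Fintype.card_ne_zero
  obtain ⟨d, hd⟩ := IsAlgClosed.exists_pow_nat_eq (Fintype.card ι : ℂ) (n := 2) (by norm_num)
  have hd0 : d ≠ 0 := by
    rintro rfl
    exact hn (by rw [← hd]; norm_num)
  obtain ⟨α, hα⟩ := IsAlgClosed.exists_pow_nat_eq (d / (β * b)) (n := 2) (by norm_num)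
  have hα0 : α ≠ 0 := by
    rintro rfl
    have : d / (β * b) ≠ 0 := div_ne_zero hd0 (mul_ne_zero hβ hb)
    exact this (by rw [← hα]; norm_num)
  have hαd : d = α ^ 2 * (β * b) := by rw [hα]; field_simp
  refine ⟨α, hα0, d, hd, ⟨α * b, mul_ne_zero hα0 hb, ?_, ?_, ?_⟩, ⟨?_, ?_⟩, ?_⟩
  · intro i
    simp [hdiag]
  · intro i
    simp only [Matrix.smul_apply, smul_eq_mul, ← Finset.mul_sum, hrow, hαd]
    field_simp
  · intro j
    simp only [Matrix.smul_apply, smul_eq_mul, ← Finset.mul_sum, hcol, hαd]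
    field_simp
  · intro i j
    exact mul_ne_zero hα0 (hB.1 i j)
  · have h1 : schurInv (α • B) = α⁻¹ • schurInv B := by
      ext i j
      simp [schurInv, mul_comm]
    rw [h1, transpose_smul, smul_mul_smul_comm, mul_inv_cancel₀ hα0, one_smul, hB.2]
  · intro r i j
    have h1 := hB.1 i j
    have h2 := hB.1 r j
    calc ∑ k, (α • B) r k * (α • B) k i / (α • B) k j
        = α * ∑ k, B r k * B k i / B k j := by
          rw [Finset.mul_sum]
          refine Finset.sum_congr rfl fun k _ => ?_
          have := hB.1 k j
          simp only [Matrix.smul_apply, smul_eq_mul]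
          field_simp
      _ = _ := by
          rw [hstar, hαd]
          simp only [Matrix.smul_apply, smul_eq_mul]
          field_simp

lemma isSpinModel_of_isEmpty [IsEmpty ι] (W : Matrix ι ι ℂ) : IsSpinModel W :=
  ⟨0, by simp, ⟨1, one_ne_zero, isEmptyElim, isEmptyElim, isEmptyElim⟩,
    ⟨isEmptyElim, Subsingleton.elim _ _⟩, isEmptyElim⟩

end JonesPairs

theorem mainTheorem12 (n : ℕ) (A B C : Matrix (Fin n) (Fin n) ℂ)
    (hAB : JonesPairs.IsInvertibleJonesPair A B)
    (hCdiag : C.IsDiag) (hCunit : IsUnit C)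
    (hC : Aᵀ = (C ^ 2)⁻¹ * A * C ^ 2)
    (hW : JonesPairs.nomura (JonesPairs.matW A B C) =
      JonesPairs.nomura (JonesPairs.matW A B C)ᵀ) :
    ∃ α : ℂ, α ≠ 0 ∧ JonesPairs.IsSpinModel (α • B) := by
  rcases isEmpty_or_nonempty (Fin n) with hempty | hne
  · exact ⟨1, one_ne_zero, JonesPairs.isSpinModel_of_isEmpty _⟩
  obtain ⟨c, rfl⟩ : ∃ c, C = Matrix.diagonal c := ⟨_, hCdiag.diagonal_diag.symm⟩
  have hc : ∀ i, c i ≠ 0 := fun i =>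
    ((Pi.isUnit_iff.1 (Matrix.isUnit_diagonal.1 hCunit)) i).ne_zero
  have hA : ∀ i j, c i ^ 2 * A j i = A i j * c j ^ 2 := by
    intro i j
    have h1 : Matrix.diagonal c ^ 2 * Aᵀ = A * Matrix.diagonal c ^ 2 := by
      rw [hC, Matrix.mul_assoc, Matrix.mul_nonsing_inv_cancel_left]
      exact (Matrix.isUnit_iff_isUnit_det _).1 (hCunit.pow 2)
    have h2 := congrFun (congrFun h1 i) j
    rw [Matrix.diagonal_pow, Matrix.diagonal_mul, Matrix.mul_diagonal] at h2
    exact h2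
  have hmem := JonesPairs.fromBlocks_mem_nomura_matW hAB hc hA
  rw [hW] at hmem
  choose μ hμ using JonesPairs.exists_eigenvalue_of_fromBlocks_mem hmem
  have hsymm : ∀ x y, B x y = B y x := by
    intro x y
    -- With the denominator column `y` fixed, the ratios are the columns of `A` with rows rescaled.
    -- Absorbing that rescaling into the row vector `B x k - B k x` lets invertibility of `A` force
    -- it to vanish.
    have h1 : Matrix.vecMul (fun k => (B x k - B k x) * (A k y)⁻¹) A = 0 := by
      ext i
      have h2 := (hμ i y x).1.trans (hμ i y x).2.symm
      rw [← sub_eq_zero, ← Finset.sum_sub_distrib] at h2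
      rw [Pi.zero_apply, ← h2, Matrix.vecMul, dotProduct]
      exact Finset.sum_congr rfl fun k _ => by ring
    have h3 := congrFun (Matrix.vecMul_injective_of_isUnit hAB.isJonesPair.left.isUnit
      (h1.trans (Matrix.zero_vecMul A).symm)) y
    exact sub_eq_zero.1 ((mul_eq_zero.1 h3).resolve_right
      (inv_ne_zero (hAB.schurInvertible y y)))
  obtain ⟨b, hb, hdiag, hstar⟩ := hAB.star_triangle hsymm μ fun i j x => (hμ i j x).1
  exact JonesPairs.isSpinModel_smul_of_star_triangle hAB.trace_ne_zero hb hAB.isTypeII_right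
    hAB.sum_row hAB.isJonesPair.left.sum_col hdiag hstar
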